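/- Let $G$ be a finite group and let $T_{11},T_{22},T_{12},T_{21}\subseteq G$ be subsets each of which is closed under conjugation. Let $\Gamma=\mathrm{SC}(G,T_{11},T_{22},T_{12},T_{21})$ be the corresponding (quasi-abelian) semi-Cayley digraph: its vertices are two disjoint copies $\{g_1\mid g\in G\}$, $\{g_2\mid g\in G\}$ of $G$, and for $i,j\in\{1,2\}$ there is an arc from $h_i$ to $g_j$ if and only if $gh^{-1}\in T_{ij}$. The splitting field $\mathrm{SF}(\Gamma)\subseteq\mathbb{C}$ is the smallest extension of $\mathbb{Q}$ that contains all eigenvalues of the adjacency matrix of $\Gamma$, and $\deg(\Gamma)=[\mathrm{SF}(\Gamma):\mathbb{Q}]$. For multisets $X,Y$ of elements of $G$, put $XY=[xy\mid x\in X,\,y\in Y]$ and $X^t=[x^t\mid x\in X]$; let $X\cup Y$ be the union with multiplicities added, $k*X$ the multiset with all multiplicities of $X$ multiplied by $k$, and $X\setminus Y$ the multiset in which $x$ has multiplicity $\max(a_x-b_x,0)$, where $a_x,b_x$ are the multiplicities of $x$ in $X,Y$. Define $$I_1=T_{11}\cup T_{22},\qquad I_2=(T_{11}T_{11})\cup(T_{22}T_{22})\cup(4*T_{12}T_{21}),\qquad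 I_3=2*T_{11}T_{22}.$$ Let $\mathrm{Irr}(G)$ be the set of irreducible complex characters of $G$. For $\chi\in\mathrm{Irr}(G)$ and a multiset $A$ of elements of $G$ put $d_\chi=\chi(1)$, $\chi(A)=\sum_{a\in A}\chi(a)$ (with multiplicity), and $$\delta_\chi=d_\chi\bigl(\chi(I_2\setminus I_3)-\chi(I_3\setminus I_2)\bigr).$$ Let $\sqrt{\delta_\chi}$ denote an arbitrarily chosen complex square root of $\delta_\chi$. Let $m$ be the exponent of $G$, let $\omega_m\in\mathbb{C}$ be a primitive $m$-th root of unity, and let $\eta:\mathrm{Gal}(\mathbb{Q}(\omega_m)/\mathbb{Q})\to\mathbb{Z}_m^*$ be the isomorphism with $\sigma(\omega_m)=\omega_m^{\eta(\sigma)}$. Put $$T=\{t\in\mathbb{Z}_m^*\mid I_1^t=I_1,\ (I_2\setminus I_3)^t=I_2\setminus I_3,\ (I_3\setminus I_2)^t=I_3\setminus I_2\},$$ $$K=\mathbb{Q}\bigl(\chi(I_1),\ \chi(I_2\setminus I_3)-\chi(I_3\setminus I_2)\mid\chi\in\mathrm{Irr}(G)\bigr).$$ Then $$K=\{x\in\mathbb{Q}(\omega_m)\mid\sigma(x)=x\text{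 for all }\sigma\in\eta^{-1}(T)\},$$ $$\mathrm{SF}(\Gamma)=\mathbb{Q}\bigl(\chi(I_1),\sqrt{\delta_\chi}\mid\chi\in\mathrm{Irr}(G)\bigr)=K\bigl(\sqrt{\delta_\chi}\mid\chi\in\mathrm{Irr}(G)\bigr).$$ Moreover, every $\delta_\chi$ lies in $K$, and $$\deg(\Gamma)=\frac{\varphi(m)\,|M|}{|T|},$$ where $\varphi$ is Euler's function and $M$ is the subgroup of $K^\times/K^{\times2}$, with $K^{\times 2}=\{k^2\mid k\in K^\times\}$, generated by the classes of those $\delta_\chi$, $\chi\in\mathrm{Irr}(G)$, that are nonzero. -/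

import Mathlib

open IntermediateField

noncomputable section

namespace SemiCayley

section Groups

variable {G : Type*} [Group G]

/-- A subset of a group that is closed under conjugation, i.e. a union of conjugacy classes. -/
def ConjClosed (S : Finset G) : Prop :=
  ∀ s ∈ S, ∀ g : G, g⁻¹ * s * g ∈ S

/-- The multiset `XY = [xy | x ∈ X, y ∈ Y]`. -/
def mulMultiset (X Y : Multiset G) : Multiset G :=
  (X ×ˢ Y).map fun p => p.1 * p.2

/-- The multiset `X ^ t = [x ^ t | x ∈ X]` for a residue `t` modulo the exponent of the group. -/
def powMultiset (X : Multiset G) (t : (ZMod (Monoid.exponent G))ˣ) : Multiset G :=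
  X.map fun x => x ^ (t : ZMod (Monoid.exponent G)).val

/-- The set `Irr(G)` of the irreducible complex characters of `G`. -/
def Irr (G : Type*) [Group G] : Set (G → ℂ) :=
  {χ | ∃ (V : Type) (_ : AddCommGroup V) (_ : Module ℂ V) (_ : FiniteDimensional ℂ V)
    (ρ : Representation ℂ G V), ρ.IsIrreducible ∧ χ = ρ.character}

/-- `χ(A) = ∑ a ∈ A, χ(a)`, summed with multiplicity. -/
def charSum (χ : G → ℂ) (A : Multiset G) : ℂ :=
  (A.map χ).sum

/-- The semi-Cayley digraph `SC(G, T₁₁, T₂₂, T₁₂, T₂₁)`; `Sum.inl g` and `Sum.inr g` are the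
vertices `g₁` and `g₂`. -/
def graph (T11 T22 T12 T21 : Finset G) : Digraph (G ⊕ G) where
  Adj
    | Sum.inl h, Sum.inl g => g * h⁻¹ ∈ T11
    | Sum.inr h, Sum.inr g => g * h⁻¹ ∈ T22
    | Sum.inl h, Sum.inr g => g * h⁻¹ ∈ T12
    | Sum.inr h, Sum.inl g => g * h⁻¹ ∈ T21

/-- `SC(G, T₁₁, T₂₂, T₁₂, T₂₁)` is quasi-abelian. -/
def IsQuasiAbelian (T11 T22 T12 T21 : Finset G) : Prop :=
  ConjClosed T11 ∧ ConjClosed T22 ∧ ConjClosed T12 ∧ ConjClosed T21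

/-- The multiset `I₁ = T₁₁ ∪ T₂₂` (unions of multisets add multiplicities). -/
def I1 (T11 T22 : Finset G) : Multiset G :=
  T11.val + T22.val

/-- The multiset `I₂ = T₁₁T₁₁ ∪ T₂₂T₂₂ ∪ 4 * T₁₂T₂₁`. -/
def I2 (T11 T22 T12 T21 : Finset G) : Multiset G :=
  mulMultiset T11.val T11.val + mulMultiset T22.val T22.val + 4 • mulMultiset T12.val T21.val

/-- The multiset `I₃ = 2 * T₁₁T₂₂`. -/
def I3 (T11 T22 : Finset G) : Multiset G :=
  2 • mulMultiset T11.val T22.val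

variable [DecidableEq G]

/-- `χ(I₂ ∖ I₃) - χ(I₃ ∖ I₂)`; subtraction of multisets truncates multiplicities at zero. -/
def charDiff (T11 T22 T12 T21 : Finset G) (χ : G → ℂ) : ℂ :=
  charSum χ (I2 T11 T22 T12 T21 - I3 T11 T22) - charSum χ (I3 T11 T22 - I2 T11 T22 T12 T21)

/-- The radicand `d_χ (χ(I₂ ∖ I₃) - χ(I₃ ∖ I₂))`, where `d_χ = χ(1)`. -/
def radicand (T11 T22 T12 T21 : Finset G) (χ : G → ℂ) : ℂ :=
  χ 1 * charDiff T11 T22 T12 T21 χ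

/-- `T = {t ∈ ℤ_m^* | I₁^t = I₁, (I₂ ∖ I₃)^t = I₂ ∖ I₃, (I₃ ∖ I₂)^t = I₃ ∖ I₂}`, where `m` is the
exponent of the group. -/
def stabilizer (T11 T22 T12 T21 : Finset G) : Set (ZMod (Monoid.exponent G))ˣ :=
  {t | powMultiset (I1 T11 T22) t = I1 T11 T22 ∧
    powMultiset (I2 T11 T22 T12 T21 - I3 T11 T22) t = I2 T11 T22 T12 T21 - I3 T11 T22 ∧
    powMultiset (I3 T11 T22 - I2 T11 T22 T12 T21) t = I3 T11 T22 - I2 T11 T22 T12 T21}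

/-- `K = ℚ(χ(I₁), χ(I₂ ∖ I₃) - χ(I₃ ∖ I₂) | χ ∈ Irr(G))`. -/
def baseField (T11 T22 T12 T21 : Finset G) : IntermediateField ℚ ℂ :=
  adjoin ℚ ((fun χ : G → ℂ => charSum χ (I1 T11 T22)) '' Irr G ∪
    charDiff T11 T22 T12 T21 '' Irr G)

end Groups

section Digraphs

variable {V : Type*} [Fintype V] [DecidableEq V]

open Classical in
/-- The adjacency matrix of a finite digraph, with complex entries. -/
def adjacencyMatrix (Γ : Digraph V) : Matrix V V ℂ :=
  Matrix.of fun v w => if Γ.Adj v w then 1 else 0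

/-- The splitting field of a finite digraph: the smallest subfield of `ℂ` that contains all
eigenvalues of the adjacency matrix. -/
def splittingField (Γ : Digraph V) : IntermediateField ℚ ℂ :=
  adjoin ℚ {z : ℂ | (adjacencyMatrix Γ).charpoly.IsRoot z}

/-- The algebraic degree of a finite digraph. -/
def algebraicDegree (Γ : Digraph V) : ℕ :=
  Module.finrank ℚ (splittingField Γ)

end Digraphs

section Fields

/-- The generator of `ℚ(ω)` is a primitive `m`-th root of unity if `ω` is. -/
theorem isPrimitiveRoot_gen {m : ℕ} {ω : ℂ} (hω : IsPrimitiveRoot ω m) :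
    IsPrimitiveRoot (AdjoinSimple.gen ℚ ω) m := by
  refine IsPrimitiveRoot.of_map_of_injective (f := (ℚ⟮ω⟯).val) ?_ (ℚ⟮ω⟯).val.injective
  simpa using hω

/-- The homomorphism `η : Gal(ℚ(ω)/ℚ) → ℤ_m^*` with `σ(ω) = ω ^ η(σ)`. -/
def eta {m : ℕ} [NeZero m] {ω : ℂ} (hω : IsPrimitiveRoot ω m) :
    (ℚ⟮ω⟯ ≃ₐ[ℚ] ℚ⟮ω⟯) →* (ZMod m)ˣ :=
  (isPrimitiveRoot_gen hω).autToPow ℚ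

/-- The subgroup of `K^× / K^{×2}` generated by the classes of the nonzero elements of `K` that
belong to `R`. -/
def squareClassGroup (K : IntermediateField ℚ ℂ) (R : Set ℂ) :
    Subgroup (Kˣ ⧸ (powMonoidHom 2 : Kˣ →* Kˣ).range) :=
  Subgroup.closure {q | ∃ u : Kˣ, ((u : K) : ℂ) ∈ R ∧ QuotientGroup.mk u = q}

end Fields

end SemiCayley

end

/-! The adjacency operator commutes with right translations of functions on the two copies of G. By
Schur's lemma, on a vector of an irreducible constituent with character χ each class function acts
as a scalar; the conjugation-closed `Tij` acts as χ(Tij)/χ(1). The eigenvalues are therefore those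
of the 2 × 2 matrices (χ(Tij))/χ(1). Multiplicativity of central characters turns the discriminant
of (χ(Tij)) into δ_χ (`radicand_eq`), so they are (χ(I₁) ± √δ_χ)/(2χ(1)) (`isRoot_iff`). Sums and
differences of such pairs recover the stated generators of the splitting field.

An automorphism σ of ℚ(ω) sends χ(g) to χ(g ^ η(σ)). No nonzero class function is orthogonal to all
irreducible characters (`IsClassFunction.eq_zero`), so σ fixes all generators of K exactly when the
multiplicity functions behind them are invariant under the power map, that is, η(σ) ∈ T
(`eta_mem_stabilizer_iff`). The Galois correspondence then describes K and gives [K:ℚ]·|T| = φ(m).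

The rest of the degree is Kummer theory of exponent 2: one square root for each class in M gives a
K-basis of the splitting field (`finrank_adjoin_eq_card_squareClassGroup`). -/

namespace SemiCayley

/-! ### Characters, Schur's lemma and completeness of the irreducible characters -/

section RepresentationTheory

variable {G : Type*} [Group G]

/-- An endomorphism `f` with `f ^ m = 1` is diagonalizable with `m`-th roots of unity as
eigenvalues, so the traces of its powers are power sums. -/
theorem exists_trace_pow_eq_sum {V : Type*} [AddCommGroup V] [Module ℂ V]
    [FiniteDimensional ℂ V] {m : ℕ} [NeZero m] {ω : ℂ} (hω : IsPrimitiveRoot ω m)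
    (f : Module.End ℂ V) (hf : f ^ m = 1) :
    ∃ n : ℕ → ℕ, ∀ t : ℕ,
      LinearMap.trace ℂ V (f ^ t) = ∑ j ∈ Finset.range m, (n j : ℂ) * ω ^ (j * t) := by
  have hω0 : ω ≠ 0 := hω.ne_zero (NeZero.ne m)
  have hm : (m : ℂ) ≠ 0 := Nat.cast_ne_zero.mpr (NeZero.ne m)
  have hω1 : ω ^ m = 1 := hω.pow_eq_one
  let u : ℕ → Module.End ℂ V := fun j => (ω⁻¹ ^ j) • f
  -- The average of the powers of `ω⁻ʲ f` is the projection onto the `ω ^ j`-eigenspace of `f`.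
  let e : ℕ → Module.End ℂ V := fun j => (m : ℂ)⁻¹ • ∑ i ∈ Finset.range m, u j ^ i
  have hum : ∀ j, u j ^ m = 1 := fun j => by
    simp only [u]
    rw [smul_pow, hf, ← pow_mul, mul_comm, pow_mul, inv_pow, hω1]; simp
  have hue : ∀ j, u j * e j = e j := fun j => by
    have h := mul_geom_sum (u j) m
    rw [hum, sub_self, sub_mul, one_mul, sub_eq_zero] at h
    simp only [e]
    rw [mul_smul_comm, h]
  have hfe : ∀ j, f * e j = ω ^ j • e j := fun j => by
    have h := congrArg (fun x => ω ^ j • x) (hue j)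
    simp only [u] at h
    rw [smul_mul_assoc, smul_smul, ← mul_pow, mul_inv_cancel₀ hω0, one_pow, one_smul] at h
    exact h
  have hfte : ∀ j t, f ^ t * e j = ω ^ (j * t) • e j := fun j t => by
    induction t with
    | zero => simp
    | succ t ih => rw [pow_succ, mul_assoc, hfe, mul_smul_comm, ih, smul_smul]; ring_nf
  have hid : ∀ j, IsIdempotentElem (e j) := fun j => by
    have h : ∀ i, u j ^ i * e j = e j := fun i => by
      induction i with
      | zero => simp
      | succ i ih => rw [pow_succ, mul_assoc, hue, ih]
    change e j * e j = e j
    conv_lhs => lhs; simp only [e]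
    rw [smul_mul_assoc, Finset.sum_mul, Finset.sum_congr rfl fun i _ => h i]
    rw [Finset.sum_const, Finset.card_range, ← Nat.cast_smul_eq_nsmul ℂ, smul_smul,
      inv_mul_cancel₀ hm, one_smul]
  have hsum : ∑ j ∈ Finset.range m, e j = 1 := by
    simp only [e, u]
    rw [← Finset.smul_sum, Finset.sum_comm]
    rw [Finset.sum_eq_single 0]
    · simp [← Nat.cast_smul_eq_nsmul ℂ, smul_smul, hm]
    · intro i hi hi0
      simp_rw [smul_pow]
      rw [← Finset.sum_smul]
      have hx : (ω⁻¹ ^ i) ≠ 1 := by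
        rw [inv_pow, Ne, inv_eq_one]
        exact hω.pow_ne_one_of_pos_of_lt hi0 (Finset.mem_range.mp hi)
      have h := mul_geom_sum (ω⁻¹ ^ i) m
      have h1 : (ω⁻¹ ^ i) ^ m = 1 := by rw [← pow_mul, mul_comm, pow_mul, inv_pow, hω1]; simp
      rw [h1, sub_self] at h
      have h2 := (mul_eq_zero.mp h).resolve_left (sub_ne_zero.mpr hx)
      have h3 : ∑ j ∈ Finset.range m, (ω⁻¹ ^ j) ^ i = 0 := by
        rw [← h2]; exact Finset.sum_congr rfl fun j _ => by rw [← pow_mul, ← pow_mul, mul_comm]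
      rw [h3, zero_smul]
    · intro h; exact absurd (Finset.mem_range.mpr (NeZero.pos m)) h
  -- The multiplicities are the ranks of the projections, since an idempotent has its rank as trace;
  -- they do not depend on `t`.
  refine ⟨fun j => Module.finrank ℂ (LinearMap.range (e j)), fun t => ?_⟩
  rw [← mul_one (f ^ t), ← hsum, Finset.mul_sum, map_sum]
  refine Finset.sum_congr rfl fun j _ => ?_
  rw [hfte, map_smul, ← (LinearMap.IsIdempotentElem.isProj_range _ (hid j)).trace, smul_eq_mul,
    mul_comm]

variable {χ : G → ℂ}

theorem Irr.exists_natCast_eq_one (hχ : χ ∈ Irr G) : ∃ d : ℕ, d ≠ 0 ∧ χ 1 = d := by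
  obtain ⟨V, _, _, _, ρ, hρ, rfl⟩ := hχ
  refine ⟨Module.finrank ℂ V, ?_, ρ.char_one⟩
  intro h
  have := Module.finrank_zero_iff.mp h
  obtain ⟨x, y, hxy⟩ := hρ.exists_pair_ne
  exact hxy (Subrepresentation.toSubmodule_injective (Subsingleton.elim _ _))

theorem Irr.one_ne_zero (hχ : χ ∈ Irr G) : χ 1 ≠ 0 := by
  obtain ⟨d, hd, h⟩ := Irr.exists_natCast_eq_one hχ
  rw [h]; exact_mod_cast hd

theorem Irr.exists_pow_eq_sum [Finite G] (hχ : χ ∈ Irr G) {ω : ℂ}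
    (hω : IsPrimitiveRoot ω (Monoid.exponent G)) (g : G) :
    ∃ n : ℕ → ℕ, ∀ t : ℕ,
      χ (g ^ t) = ∑ j ∈ Finset.range (Monoid.exponent G), (n j : ℂ) * ω ^ (j * t) := by
  obtain ⟨V, _, _, _, ρ, hρ, rfl⟩ := hχ
  obtain ⟨n, hn⟩ := exists_trace_pow_eq_sum hω (ρ g)
    (by rw [← map_pow, Monoid.pow_exponent_eq_one, map_one])
  exact ⟨n, fun t => by rw [← hn t, Representation.character, map_pow]⟩

variable [Fintype G]

/-- The action of an element of the group algebra, given by its coefficients. -/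
def groupSum {V : Type*} [AddCommGroup V] [Module ℂ V] (ρ : Representation ℂ G V) (a : G → ℂ) :
    Module.End ℂ V :=
  ∑ g, a g • ρ g

/-- Class functions on `G`. -/
def IsClassFunction {R : Type*} (a : G → R) : Prop :=
  ∀ x g, a (x * g * x⁻¹) = a g

theorem groupSum_comm {V : Type*} [AddCommGroup V] [Module ℂ V] (ρ : Representation ℂ G V)
    {a : G → ℂ} (ha : IsClassFunction a) (x : G) :
    groupSum ρ a * ρ x = ρ x * groupSum ρ a := by
  rw [groupSum, Finset.sum_mul, Finset.mul_sum]
  refine Fintype.sum_equiv (MulAut.conj x⁻¹).toEquiv _ _ fun g => ?_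
  simp only [MulEquiv.toEquiv_eq_coe, EquivLike.coe_coe, MulAut.conj_apply]
  rw [ha, smul_mul_assoc, mul_smul_comm, ← map_mul, ← map_mul]
  congr 2; group

theorem trace_groupSum_mul {V : Type*} [AddCommGroup V] [Module ℂ V]
    (ρ : Representation ℂ G V) (a : G → ℂ) (h : G) :
    LinearMap.trace ℂ V (groupSum ρ a * ρ h) = ∑ g, a g * ρ.character (g * h) := by
  simp [groupSum, Finset.sum_mul, Representation.character, map_sum]

/-- Schur's lemma for the action of a class function on an irreducible representation. -/
theorem groupSum_eq_smul {V : Type*} [AddCommGroup V] [Module ℂ V] [FiniteDimensional ℂ V]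
    (ρ : Representation ℂ G V) (hρ : ρ.IsIrreducible) (hd : ρ.character 1 ≠ 0) {a : G → ℂ}
    (ha : IsClassFunction a) :
    groupSum ρ a = ((∑ g, a g * ρ.character g) / ρ.character 1) • 1 := by
  let F : Representation.IntertwiningMap ρ ρ := ⟨groupSum ρ a, fun g => groupSum_comm ρ ha g⟩
  obtain ⟨c, hc⟩ :=
    (Representation.IsIrreducible.algebraMap_intertwiningMap_bijective_of_isAlgClosed
      (ρ := ρ) (k := ℂ)).2 F
  have hc' : groupSum ρ a = c • 1 := by
    have := congrArg (fun f : Representation.IntertwiningMap ρ ρ => f.toLinearMap) hc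
    exact this.symm
  have ht := trace_groupSum_mul ρ a 1
  simp only [map_one, mul_one] at ht
  rw [← ht, hc', map_smul, LinearMap.trace_one, smul_eq_mul, ← ρ.char_one, mul_div_assoc,
    div_self hd, mul_one]

/-- Take traces after multiplying the scalar operator `groupSum ρ a` by `ρ h`. -/
theorem Irr.one_mul_sum (hχ : χ ∈ Irr G) {a : G → ℂ} (ha : IsClassFunction a) (h : G) :
    χ 1 * ∑ g, a g * χ (g * h) = (∑ g, a g * χ g) * χ h := by
  have hd := Irr.one_ne_zero hχ
  obtain ⟨V, _, _, _, ρ, hρ, rfl⟩ := hχ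
  rw [← trace_groupSum_mul, groupSum_eq_smul ρ hρ hd ha, smul_mul_assoc, one_mul, map_smul,
    smul_eq_mul, ← mul_assoc, mul_div_cancel₀ _ hd, Representation.character]

/-- Every nonzero invariant subspace contains a nonzero vector on which all class functions act
through an irreducible character. -/
theorem exists_irr_of_ne_bot {W : Type*} [AddCommGroup W] [Module ℂ W] [FiniteDimensional ℂ W]
    {R : Representation ℂ G W} (E : Subrepresentation R) (hE : E ≠ ⊥) :
    ∃ χ ∈ Irr G, ∃ f ∈ E, f ≠ 0 ∧ ∀ a : G → ℂ, IsClassFunction a →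
      groupSum R a f = ((∑ g, a g * χ g) / χ 1) • f := by
  have hwf : WellFoundedLT (Subrepresentation R) :=
    StrictMono.wellFoundedLT (f := fun S : Subrepresentation R => S.toSubmodule)
      (fun _ _ h => h)
  have : IsAtomic (Subrepresentation R) := isAtomic_of_orderBot_wellFounded_lt hwf.wf
  obtain ⟨V, hV, hVE⟩ := (IsAtomic.eq_bot_or_exists_atom_le E).resolve_left hE
  obtain ⟨f, hfV, hf0⟩ : ∃ f ∈ V.toSubmodule, f ≠ 0 :=
    Submodule.exists_mem_ne_zero_of_ne_bot fun h =>
      hV.1 (Subrepresentation.toSubmodule_injective h)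
  -- `Irr` asks for a space in `Type`, while `W` lives in any universe; coordinates move the minimal
  -- invariant subspace there.
  let φ : V.toSubmodule ≃ₗ[ℂ] (Fin (Module.finrank ℂ V.toSubmodule) → ℂ) :=
    (Module.finBasis ℂ V.toSubmodule).equivFun
  let ρ : Representation ℂ G (Fin (Module.finrank ℂ V.toSubmodule) → ℂ) :=
    (φ.conjAlgEquiv ℂ : Module.End ℂ V.toSubmodule →* _).comp V.toRepresentation
  have hρφ : ∀ g v, ((φ.symm (ρ g (φ v)) : V.toSubmodule) : W) = R g v := fun g v => by
    simp [ρ, LinearEquiv.conjAlgEquiv, Subrepresentation.toRepresentation]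
  have hirr : ρ.IsIrreducible := by
    refine { exists_pair_ne := ⟨⊥, ⊤, fun h => ?_⟩, eq_bot_or_eq_top := fun S => ?_ }
    · have h1 : φ ⟨f, hfV⟩ ∈ (⊥ : Subrepresentation ρ) := by rw [h]; trivial
      have h2 : φ ⟨f, hfV⟩ = 0 := h1
      rw [LinearEquiv.map_eq_zero_iff] at h2
      exact hf0 (congrArg Subtype.val h2)
    · let S' : Subrepresentation R :=
        { toSubmodule := (S.toSubmodule.comap φ.toLinearMap).map V.toSubmodule.subtype
          apply_mem_toSubmodule := by
            rintro g _ ⟨v, hv, rfl⟩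
            refine ⟨⟨R g v, V.apply_mem_toSubmodule g v.2⟩, ?_, rfl⟩
            have := S.apply_mem_toSubmodule g hv
            have h2 : (⟨R g v, V.apply_mem_toSubmodule g v.2⟩ : V.toSubmodule) =
              φ.symm (ρ g (φ v)) := Subtype.ext (hρφ g v).symm
            rw [h2]
            simpa using this }
      have hS' : S' ≤ V := by
        rintro _ ⟨v, hv, rfl⟩
        exact v.2
      rcases hV.le_iff.mp hS' with h | h
      · left
        apply Subrepresentation.toSubmodule_injective
        refine (Submodule.eq_bot_iff _).mpr fun x hx => ?_
        have : ((φ.symm x : V.toSubmodule) : W) ∈ S' := ⟨φ.symm x, by simpa using hx, rfl⟩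
        rw [h] at this
        have h3 : ((φ.symm x : V.toSubmodule) : W) = 0 := this
        simpa using h3
      · right
        apply Subrepresentation.toSubmodule_injective
        refine (Submodule.eq_top_iff').mpr fun x => ?_
        have : ((φ.symm x : V.toSubmodule) : W) ∈ S' := by rw [h]; exact (φ.symm x).2
        obtain ⟨v, hv, hvx⟩ := this
        have : v = φ.symm x := Subtype.ext hvx
        rw [this] at hv
        simpa using hv
  have hχ : ρ.character ∈ Irr G := ⟨_, _, _, inferInstance, ρ, hirr, rfl⟩
  refine ⟨ρ.character, hχ, f, hVE hfV, hf0, fun a ha => ?_⟩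
  have h := groupSum_eq_smul ρ hirr (Irr.one_ne_zero hχ) ha
  have h2 : ((φ.symm (groupSum ρ a (φ ⟨f, hfV⟩)) : V.toSubmodule) : W) = groupSum R a f := by
    simp [groupSum, LinearMap.sum_apply, map_sum, hρφ]
  rw [← h2, h]
  simp

/-- A class function that is orthogonal to all irreducible characters vanishes. -/
theorem IsClassFunction.eq_zero {a : G → ℂ} (ha : IsClassFunction a)
    (h : ∀ χ ∈ Irr G, ∑ g, a g * χ g = 0) : a = 0 := by
  classical
  let R : Representation ℂ G (G → ℂ) :=
    { toFun := fun x => LinearMap.funLeft ℂ ℂ (· * x)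
      map_one' := by ext; simp [LinearMap.funLeft]
      map_mul' := fun x y => by
        refine LinearMap.ext fun f => funext fun g => ?_
        simp [LinearMap.funLeft, mul_assoc] }
  let E : Subrepresentation R :=
    { toSubmodule := LinearMap.ker (groupSum R a)
      apply_mem_toSubmodule := fun g v hv => by
        rw [LinearMap.mem_ker] at hv ⊢
        rw [← Module.End.mul_apply, groupSum_comm R ha, Module.End.mul_apply, hv, map_zero] }
  -- Maschke: the kernel `E` of `a` has an invariant complement. If nonzero, it would contain a
  -- nonzero vector on which `a` acts as 0, that is, a vector of `E`.
  obtain ⟨E', hE'⟩ := exists_isCompl E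
  have hbot : E' = ⊥ := by
    by_contra hne
    obtain ⟨χ, hχ, f, hf, hf0, hfa⟩ := exists_irr_of_ne_bot E' hne
    have hfE : f ∈ E := by
      change groupSum R a f = 0
      rw [hfa a ha, h χ hχ, zero_div, zero_smul]
    have : f ∈ E ⊓ E' := ⟨hfE, hf⟩
    rw [hE'.inf_eq_bot] at this
    exact hf0 this
  have htop : E = ⊤ := by simpa [hbot] using hE'.sup_eq_top
  funext g
  -- Hence `a` acts as 0 on the regular representation; applied to the delta function at `g` and
  -- evaluated at 1, it returns `a g`.
  have : Pi.single g 1 ∈ E := by rw [htop]; trivial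
  have h1 : groupSum R a (Pi.single g 1) = 0 := this
  have h2 := congrFun h1 1
  simpa [groupSum, LinearMap.sum_apply, R, LinearMap.funLeft, Pi.single_apply] using h2

end RepresentationTheory

end SemiCayley

namespace SemiCayley

/-! ### Kummer theory for square roots -/

section Kummer

/-- The degree of the field obtained by adjoining square roots is the order of the group that the
radicands generate modulo squares. -/
theorem finrank_adjoin_eq_card_squareClassGroup (K : IntermediateField ℚ ℂ) (S : Set ℂ)
    (hS : ∀ x ∈ S, x ^ 2 ∈ K) :
    Module.finrank K (adjoin K S) = Nat.card (squareClassGroup K ((fun x => x ^ 2) '' S)) := by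
  set L := adjoin K S with hL
  set M := squareClassGroup K ((fun x => x ^ 2) '' S) with hM
  have hint : ∀ x ∈ S, IsIntegral K x := fun x hx =>
    IsIntegral.of_pow two_pos (isIntegral_algebraMap (x := (⟨x ^ 2, hS x hx⟩ : K)))
  have hsplit : ∀ x ∈ S, ((minpoly K x).map (algebraMap K L)).Splits := by
    intro x hx
    let c : K := ⟨x ^ 2, hS x hx⟩
    let y : L := ⟨x, subset_adjoin K S hx⟩
    have hdvd : minpoly K x ∣ Polynomial.X ^ 2 - Polynomial.C c := by
      apply minpoly.dvd
      simp only [map_sub, map_pow, Polynomial.aeval_X, Polynomial.aeval_C]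
      exact sub_self _
    have hfac : (Polynomial.X ^ 2 - Polynomial.C c).map (algebraMap K L) =
        (Polynomial.X - Polynomial.C y) * (Polynomial.X - Polynomial.C (-y)) := by
      have : algebraMap K L c = y ^ 2 := rfl
      simp only [Polynomial.map_sub, Polynomial.map_pow, Polynomial.map_X, Polynomial.map_C, this,
        Polynomial.C_neg, Polynomial.C_pow]
      ring
    have hne : (Polynomial.X ^ 2 - Polynomial.C c).map (algebraMap K L) ≠ 0 := by
      rw [hfac]
      exact mul_ne_zero (Polynomial.X_sub_C_ne_zero _) (Polynomial.X_sub_C_ne_zero _)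
    refine Polynomial.Splits.of_dvd ?_ hne (Polynomial.map_dvd _ hdvd)
    rw [hfac]
    exact (Polynomial.Splits.X_sub_C _).mul (Polynomial.Splits.X_sub_C _)
  have halg : Algebra.IsAlgebraic K L := isAlgebraic_adjoin hint
  have hnormal : Normal K L := by
    refine normal_iff.mpr fun x => ⟨Algebra.IsIntegral.isIntegral x, ?_⟩
    have := splits_of_mem_adjoin K ℂ (L := L) (fun x hx => ⟨hint x hx, hsplit x hx⟩) x.2
    rwa [← minpoly_eq] at this
  have hgal : IsGalois K L := {}
  -- Having a representative with a square root in `L` holds for the generating classes and passes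
  -- to products and inverses.
  have hroot : ∀ q : M, ∃ s : L, s ≠ 0 ∧ ∃ u : Kˣ,
      (QuotientGroup.mk u : Kˣ ⧸ (powMonoidHom 2 : Kˣ →* Kˣ).range) = q ∧
        s ^ 2 = algebraMap K L u := by
    rintro ⟨q, hq⟩
    induction hq using Subgroup.closure_induction with
    | mem q hq =>
      obtain ⟨u, ⟨x, hx, hxu⟩, rfl⟩ := hq
      have h : (⟨x, subset_adjoin K S hx⟩ : L) ^ 2 = algebraMap K L u := Subtype.ext hxu
      refine ⟨⟨x, subset_adjoin K S hx⟩, fun h0 => ?_, u, rfl, h⟩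
      rw [h0, zero_pow two_ne_zero] at h
      exact u.ne_zero ((map_eq_zero _).mp h.symm)
    | one => exact ⟨1, one_ne_zero, 1, rfl, by simp⟩
    | mul p q _ _ hp hq =>
      obtain ⟨s, hs, u, hu, hsu⟩ := hp
      obtain ⟨t, ht, v, hv, htv⟩ := hq
      refine ⟨s * t, mul_ne_zero hs ht, u * v, ?_, ?_⟩
      · change _ = p * q
        rw [QuotientGroup.mk_mul, hu, hv]
      · rw [mul_pow, hsu, htv, Units.val_mul, map_mul]
    | inv q _ hq =>
      obtain ⟨s, hs, u, hu, hsu⟩ := hq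
      refine ⟨s⁻¹, inv_ne_zero hs, u⁻¹, ?_, ?_⟩
      · change _ = q⁻¹
        rw [QuotientGroup.mk_inv, hu]
      · rw [inv_pow, hsu, Units.val_inv_eq_inv_val, map_inv₀]
  choose s hs0 u hu hsu using hroot
  have hsign : ∀ (q : M) (σ : Gal(L/K)), σ (s q) = s q ∨ σ (s q) = -s q := fun q σ => by
    rw [← sq_eq_sq_iff_eq_or_eq_neg, ← map_pow, hsu, AlgEquiv.commutes]
  -- Representatives of one class differ by a square of K, so their roots are proportional over K.
  have hspan1 : ∀ (q : M) (v : Kˣ) (y : L), y ^ 2 = algebraMap K L v →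
      (QuotientGroup.mk v : Kˣ ⧸ (powMonoidHom 2 : Kˣ →* Kˣ).range) = q →
        y ∈ Submodule.span K (Set.range s) := by
    intro q v y hy hv
    obtain ⟨k, hk⟩ := QuotientGroup.eq.mp ((hu q).trans hv.symm)
    have hk' : (v : K) = k ^ 2 * u q := by
      have : v = k ^ 2 * u q := by
        rw [powMonoidHom_apply] at hk
        rw [hk, mul_comm, mul_inv_cancel_left]
      rw [this]; simp
    have : y ^ 2 = ((k : K) • s q) ^ 2 := by
      rw [hy, hk', smul_pow, hsu, Algebra.smul_def, map_mul]
    have hmem : (k : K) • s q ∈ Submodule.span K (Set.range s) :=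
      Submodule.smul_mem _ _ (Submodule.subset_span ⟨q, rfl⟩)
    rcases sq_eq_sq_iff_eq_or_eq_neg.mp this with h | h
    · rwa [h]
    · rw [h]; exact Submodule.neg_mem _ hmem
  have hspan : ⊤ ≤ Submodule.span K (Set.range s) := by
    have hmul : ∀ x ∈ Submodule.span K (Set.range s), ∀ y ∈ Submodule.span K (Set.range s),
        x * y ∈ Submodule.span K (Set.range s) := by
      intro x hx y hy
      induction hx, hy using Submodule.span_induction₂ with
      | mem_mem x y hx hy =>
        obtain ⟨p, rfl⟩ := hx
        obtain ⟨q, rfl⟩ := hy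
        refine hspan1 (p * q) (u p * u q) _ ?_ ?_
        · rw [mul_pow, hsu, hsu, Units.val_mul, map_mul]
        · rw [QuotientGroup.mk_mul, hu, hu]; rfl
      | zero_left y hy => simp
      | zero_right x hx => simp
      | add_left x y z _ _ _ h1 h2 => rw [add_mul]; exact Submodule.add_mem _ h1 h2
      | add_right x y z _ _ _ h1 h2 => rw [mul_add]; exact Submodule.add_mem _ h1 h2
      | smul_left r x y _ _ h => rw [smul_mul_assoc]; exact Submodule.smul_mem _ _ h
      | smul_right r x y _ _ h => rw [mul_smul_comm]; exact Submodule.smul_mem _ _ h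
    have hone : (1 : L) ∈ Submodule.span K (Set.range s) :=
      hspan1 1 1 1 (by simp) rfl
    have key : ∀ x ∈ Algebra.adjoin K S,
        ∃ y ∈ Submodule.span K (Set.range s), (y : ℂ) = x := by
      intro x hx
      induction hx using Algebra.adjoin_induction with
      | mem x hx =>
        refine ⟨⟨x, subset_adjoin K S hx⟩, ?_, rfl⟩
        -- Zero has no square class, but adds nothing to the span.
        by_cases hx0 : x = 0
        · subst hx0; exact Submodule.zero_mem _
        · let v : Kˣ := Units.mk0 ⟨x ^ 2, hS x hx⟩ fun h =>
            pow_ne_zero 2 hx0 (congrArg Subtype.val h)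
          exact hspan1 ⟨QuotientGroup.mk v, Subgroup.subset_closure ⟨v, ⟨x, hx, rfl⟩, rfl⟩⟩ v _
            rfl rfl
      | algebraMap k =>
        refine ⟨k • 1, Submodule.smul_mem _ _ hone, ?_⟩
        rw [Algebra.smul_def, mul_one]; rfl
      | add x y _ _ hx hy =>
        obtain ⟨x', hx', rfl⟩ := hx
        obtain ⟨y', hy', rfl⟩ := hy
        exact ⟨x' + y', Submodule.add_mem _ hx' hy', rfl⟩
      | mul x y _ _ hx hy =>
        obtain ⟨x', hx', rfl⟩ := hx
        obtain ⟨y', hy', rfl⟩ := hy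
        exact ⟨x' * y', hmul _ hx' _ hy', rfl⟩
    rintro x -
    obtain ⟨y, hy, hyx⟩ := key x (by
      rw [← adjoin_toSubalgebra_of_isAlgebraic fun x hx => (hint x hx).isAlgebraic]
      exact x.2)
    rwa [← Subtype.ext hyx]
  -- The Kummer pairing: its values are ±1, hence fixed by the Galois group, which makes `ψ q`
  -- multiplicative.
  let ψ : M → Gal(L/K) →* L := fun q =>
    { toFun := fun σ => σ (s q) / s q
      map_one' := div_self (hs0 q)
      map_mul' := fun σ τ => by
        rw [AlgEquiv.mul_apply]
        have := hs0 q
        rcases hsign q τ with h | h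
        · rw [h]; field_simp
        · rw [h, map_neg]; field_simp }
  have hψ : Function.Injective ψ := by
    intro p q hpq
    have hfix : ∀ σ : Gal(L/K), σ (s p / s q) = s p / s q := fun σ => by
      have h : σ (s p) / s p = σ (s q) / s q := DFunLike.congr_fun hpq σ
      have h1 := hs0 p
      have h2 := hs0 q
      have h3 : σ (s q) ≠ 0 := by simpa using h2
      rw [map_div₀]
      field_simp at h ⊢
      linear_combination h
    -- Equal characters make `s p / s q` Galois-invariant, hence an element of K, so the two classes
    -- agree. `S` may be infinite, whence the infinite Galois theory.
    obtain ⟨k, hk⟩ := (InfiniteGalois.mem_range_algebraMap_iff_fixed _).mpr hfix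
    have hk0 : k ≠ 0 := by
      rintro rfl
      rw [map_zero] at hk
      exact div_ne_zero (hs0 p) (hs0 q) hk.symm
    have huk : (u p : K) = k ^ 2 * u q := by
      apply (algebraMap K L).injective
      rw [map_mul, map_pow, hk, ← hsu, ← hsu, ← mul_pow, div_mul_cancel₀ _ (hs0 q)]
    apply Subtype.ext
    rw [← hu, ← hu, eq_comm, QuotientGroup.eq]
    refine ⟨Units.mk0 k hk0, Units.ext ?_⟩
    rw [powMonoidHom_apply, Units.val_mul, huk]
    have := (u q).ne_zero
    simp only [Units.val_pow_eq_pow_val, Units.val_mk0, Units.val_inv_eq_inv_val]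
    field_simp
  have hlin : LinearIndependent K s := by
    -- Dedekind's independence of characters: applying every σ to a relation `∑ c p • s p = 0` gives
    -- a relation between the `ψ p` with coefficients `c p * s p`.
    have hded := (linearIndependent_monoidHom Gal(L/K) L).comp ψ hψ
    rw [linearIndependent_iff'] at hded ⊢
    intro t c hc q hq
    have := hded t (fun p => algebraMap K L (c p) * s p) (by
      funext σ
      have h := congrArg σ hc
      rw [map_sum, map_zero] at h
      rw [Finset.sum_apply, Pi.zero_apply, ← h]
      refine Finset.sum_congr rfl fun p _ => ?_
      change algebraMap K L (c p) * s p * (σ (s p) / s p) = _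
      have := hs0 p
      rw [Algebra.smul_def, map_mul, AlgEquiv.commutes]
      field_simp) q hq
    simpa [hs0] using this
  exact Module.finrank_eq_nat_card_basis (Module.Basis.mk hlin hspan)

end Kummer

/-! ### Galois action on character values -/

section Galois

variable {G : Type*} [Group G]

theorem pow_unit_val_pow_inv_val [Finite G] (t : (ZMod (Monoid.exponent G))ˣ) (g : G) :
    (g ^ (t : ZMod (Monoid.exponent G)).val) ^
      ((t⁻¹ : (ZMod (Monoid.exponent G))ˣ) : ZMod (Monoid.exponent G)).val = g := by
  rw [← pow_mul]
  conv_rhs => rw [← pow_one g]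
  rw [pow_eq_pow_iff_modEq]
  refine Nat.ModEq.of_dvd (Monoid.order_dvd_exponent g) ?_
  rw [← ZMod.natCast_eq_natCast_iff]
  simp

/-- Raising to a power that is coprime to the exponent, as a permutation of the group. -/
noncomputable def powEquiv [Finite G] (t : (ZMod (Monoid.exponent G))ˣ) : G ≃ G where
  toFun g := g ^ (t : ZMod (Monoid.exponent G)).val
  invFun g := g ^ ((t⁻¹ : (ZMod (Monoid.exponent G))ˣ) : ZMod (Monoid.exponent G)).val
  left_inv g := pow_unit_val_pow_inv_val t g
  right_inv g := by simpa using pow_unit_val_pow_inv_val t⁻¹ g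

variable [Fintype G]

theorem isCyclotomicExtension_adjoin {m : ℕ} [NeZero m] {ω : ℂ} (hω : IsPrimitiveRoot ω m) :
    IsCyclotomicExtension {m} ℚ ℚ⟮ω⟯ := by
  change IsCyclotomicExtension {m} ℚ ℚ⟮ω⟯.toSubalgebra
  rw [adjoin_simple_toSubalgebra_of_isAlgebraic
    ((hω.isIntegral (NeZero.pos m)).tower_top (A := ℚ)).isAlgebraic]
  exact hω.adjoin_isCyclotomicExtension ℚ

/-- An automorphism is determined by its value at ω, and both groups have order φ(m). -/
theorem eta_bijective {m : ℕ} [NeZero m] {ω : ℂ} (hω : IsPrimitiveRoot ω m) :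
    Function.Bijective (eta hω) := by
  have := isCyclotomicExtension_adjoin hω
  have := IsCyclotomicExtension.isGalois {m} ℚ ℚ⟮ω⟯
  have := IsCyclotomicExtension.finiteDimensional {m} ℚ ℚ⟮ω⟯
  refine (Nat.bijective_iff_injective_and_card _).mpr
    ⟨(isPrimitiveRoot_gen hω).autToPow_injective ℚ, ?_⟩
  rw [IsGalois.card_aut_eq_finrank ℚ ℚ⟮ω⟯, IsCyclotomicExtension.Rat.finrank m ℚ⟮ω⟯,
    Nat.card_eq_fintype_card, ZMod.card_units_eq_totient]

variable {ω : ℂ} (hω : IsPrimitiveRoot ω (Monoid.exponent G))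

/-- χ(g) is a sum of powers of ω, and σ raises each of them to the power η(σ), as does replacing `g`
by `g ^ η(σ)`. -/
theorem Irr.exists_galois {χ : G → ℂ} (hχ : χ ∈ Irr G) (g : G) :
    ∃ y : ℚ⟮ω⟯, (y : ℂ) = χ g ∧ ∀ σ : ℚ⟮ω⟯ ≃ₐ[ℚ] ℚ⟮ω⟯,
      ((σ y : ℚ⟮ω⟯) : ℂ) = χ (powEquiv (eta hω σ) g) := by
  obtain ⟨n, hn⟩ := Irr.exists_pow_eq_sum hχ hω g
  refine ⟨∑ j ∈ Finset.range (Monoid.exponent G), (n j : ℚ⟮ω⟯) * AdjoinSimple.gen ℚ ω ^ j, ?_,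
    fun σ => ?_⟩
  · have := hn 1
    rw [pow_one] at this
    simp [this]
  · have hσ : σ (AdjoinSimple.gen ℚ ω) =
        AdjoinSimple.gen ℚ ω ^ (eta hω σ : ZMod (Monoid.exponent G)).val :=
      ((isPrimitiveRoot_gen hω).autToPow_spec ℚ σ).symm
    change _ = χ (g ^ _)
    rw [hn, map_sum]
    simp [hσ, ← pow_mul, mul_comm (ZMod.val _)]

theorem exists_galois_sum (c : G → ℤ) {χ : G → ℂ} (hχ : χ ∈ Irr G) :
    ∃ y : ℚ⟮ω⟯, (y : ℂ) = ∑ g, (c g : ℂ) * χ g ∧ ∀ σ : ℚ⟮ω⟯ ≃ₐ[ℚ] ℚ⟮ω⟯,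
      ((σ y : ℚ⟮ω⟯) : ℂ) = ∑ g, (c g : ℂ) * χ (powEquiv (eta hω σ) g) := by
  choose y hy hσ using Irr.exists_galois hω hχ
  refine ⟨∑ g, (c g : ℚ⟮ω⟯) * y g, ?_, fun σ => ?_⟩
  · simp [hy]
  · simp [hσ]

/-- An automorphism of the cyclotomic field fixes all character values of an integral class
function if and only if the class function is invariant under the corresponding power map. -/
theorem fixes_charSums_iff {c : G → ℤ} (hc : IsClassFunction c) (σ : ℚ⟮ω⟯ ≃ₐ[ℚ] ℚ⟮ω⟯) :
    (∀ χ ∈ Irr G, ∃ y : ℚ⟮ω⟯, (y : ℂ) = ∑ g, (c g : ℂ) * χ g ∧ σ y = y) ↔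
      ∀ g, c (powEquiv (eta hω σ) g) = c g := by
  set p := powEquiv (eta hω σ) with hp
  constructor
  · intro h
    -- σ replaces `c` by `c ∘ p⁻¹` in the character sums; the difference is orthogonal to all
    -- irreducible characters, so it vanishes.
    have hb : IsClassFunction fun g => ((c g - c (p.symm g) : ℤ) : ℂ) := by
      intro x g
      have : p.symm (x * g * x⁻¹) = x * p.symm g * x⁻¹ := conj_pow
      simp only [this]
      rw [hc, hc]
    have h0 := hb.eq_zero fun χ hχ => by
      obtain ⟨y, hy, hσy⟩ := h χ hχ
      obtain ⟨y', hy', hσ⟩ := exists_galois_sum hω c hχ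
      obtain rfl : y = y' := Subtype.ext (hy.trans hy'.symm)
      have h1 := hσ σ
      rw [hσy, hy, ← Equiv.sum_comp p] at h1
      rw [← Equiv.sum_comp p]
      simp only [Equiv.symm_apply_apply, Int.cast_sub, sub_mul, Finset.sum_sub_distrib]
      rw [h1, sub_self]
    intro g
    have := congrFun h0 (p g)
    simp only [Equiv.symm_apply_apply, Pi.zero_apply, Int.cast_eq_zero] at this
    exact sub_eq_zero.mp this
  · intro h χ hχ
    obtain ⟨y, hy, hσ⟩ := exists_galois_sum hω c hχ
    refine ⟨y, hy, Subtype.ext ?_⟩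
    rw [hσ, hy, ← Equiv.sum_comp p fun g => (c g : ℂ) * χ g]
    exact Finset.sum_congr rfl fun g _ => by rw [h]

end Galois

end SemiCayley

namespace SemiCayley

/-! ### Conjugation-invariant multisets and their character sums -/

section Multisets

variable {G : Type*} [Group G]

/-- A multiset is conjugation invariant. -/
def IsClassMultiset (A : Multiset G) : Prop :=
  ∀ x : G, A.map (MulAut.conj x) = A

theorem ConjClosed.mem_conj_iff {S : Finset G} (hS : ConjClosed S) (x g : G) :
    x * g * x⁻¹ ∈ S ↔ g ∈ S := by
  refine ⟨fun h => ?_, fun h => ?_⟩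
  · have := hS _ h x
    rwa [show x⁻¹ * (x * g * x⁻¹) * x = g by group] at this
  · simpa using hS _ h x⁻¹

theorem ConjClosed.isClassMultiset {S : Finset G} (hS : ConjClosed S) : IsClassMultiset S.val := by
  intro x
  have h : S.map (MulAut.conj x).toEquiv.toEmbedding = S := by
    ext g
    have hg : (MulAut.conj x).toEquiv.symm g = x⁻¹ * g * x⁻¹⁻¹ := by simp
    rw [Finset.mem_map_equiv, hg, hS.mem_conj_iff]
  exact congrArg Finset.val h

theorem IsClassMultiset.add {A B : Multiset G} (hA : IsClassMultiset A) (hB : IsClassMultiset B) :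
    IsClassMultiset (A + B) := fun x => by rw [Multiset.map_add, hA, hB]

theorem IsClassMultiset.nsmul {A : Multiset G} (hA : IsClassMultiset A) (n : ℕ) :
    IsClassMultiset (n • A) := fun x => by rw [Multiset.map_nsmul, hA]

theorem mulMultiset_map {A B : Multiset G} (f : G →* G) :
    (mulMultiset A B).map f = mulMultiset (A.map f) (B.map f) := by
  induction A using Multiset.induction_on with
  | empty => simp [mulMultiset]
  | cons a A ih =>
    simp only [mulMultiset, Multiset.map_cons, Multiset.cons_product, Multiset.map_add,
      Multiset.map_map, Function.comp_def, map_mul] at ih ⊢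
    rw [ih]

theorem IsClassMultiset.mulMultiset {A B : Multiset G} (hA : IsClassMultiset A)
    (hB : IsClassMultiset B) : IsClassMultiset (mulMultiset A B) := fun x => by
  have := mulMultiset_map (A := A) (B := B) (MulAut.conj x).toMonoidHom
  simp only [MulEquiv.toMonoidHom_eq_coe, MonoidHom.coe_coe] at this
  rw [this, hA, hB]

variable [DecidableEq G]

theorem IsClassMultiset.count {A : Multiset G} (hA : IsClassMultiset A) :
    IsClassFunction fun g => A.count g := fun x g => by
  conv_lhs => rw [← hA x]
  exact Multiset.count_map_eq_count' _ _ (MulAut.conj x).injective g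

theorem map_equiv_eq_self_iff {α : Type*} [DecidableEq α] (e : α ≃ α) (A : Multiset α) :
    A.map e = A ↔ ∀ g, A.count (e g) = A.count g := by
  have hcount : ∀ g, (A.map e).count (e g) = A.count g :=
    Multiset.count_map_eq_count' _ _ e.injective
  refine ⟨fun h g => ?_, fun h => Multiset.ext.mpr fun g => ?_⟩
  · rw [← hcount g, h]
  · obtain ⟨g, rfl⟩ := e.surjective g
    rw [hcount, h]

omit [Group G] [DecidableEq G] in
theorem charSum_add (χ : G → ℂ) (A B : Multiset G) :
    charSum χ (A + B) = charSum χ A + charSum χ B := by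
  simp [charSum]

omit [Group G] [DecidableEq G] in
theorem charSum_nsmul (χ : G → ℂ) (n : ℕ) (A : Multiset G) :
    charSum χ (n • A) = n * charSum χ A := by
  simp [charSum, Multiset.map_nsmul, Multiset.sum_nsmul]

omit [Group G] in
theorem charSum_eq_sum_count [Fintype G] (χ : G → ℂ) (A : Multiset G) :
    charSum χ A = ∑ g, ((A.count g : ℤ) : ℂ) * χ g := by
  rw [charSum, Finset.sum_multiset_map_count]
  simp only [nsmul_eq_mul, Int.cast_natCast]
  refine Finset.sum_subset (Finset.subset_univ _) fun g _ hg => ?_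
  rw [Multiset.mem_toFinset, ← Multiset.count_eq_zero] at hg
  simp [hg]

/-- The indicator function of a set of group elements. -/
def indicator (S : Finset G) (g : G) : ℂ :=
  if g ∈ S then 1 else 0

theorem ConjClosed.isClassFunction_indicator {S : Finset G} (hS : ConjClosed S) :
    IsClassFunction (indicator S) := fun x g => by
  simp only [indicator, hS.mem_conj_iff]

omit [Group G] in
theorem sum_indicator_mul [Fintype G] (S : Finset G) (f : G → ℂ) :
    ∑ g, indicator S g * f g = ∑ g ∈ S, f g := by
  simp [indicator]

omit [Group G] in
theorem sum_indicator_mul_eq_charSum [Fintype G] (S : Finset G) (χ : G → ℂ) :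
    ∑ g, indicator S g * χ g = charSum χ S.val :=
  sum_indicator_mul S χ

/-- The sum of the elements of `S` acts as the scalar χ(S)/χ(1). -/
theorem Irr.one_mul_charSum_mulMultiset [Fintype G] {χ : G → ℂ} (hχ : χ ∈ Irr G) {S : Finset G}
    (hS : ConjClosed S) (T : Finset G) :
    χ 1 * charSum χ (mulMultiset S.val T.val) = charSum χ S.val * charSum χ T.val := by
  have h : charSum χ (mulMultiset S.val T.val) = ∑ t ∈ T, ∑ s ∈ S, χ (s * t) := by
    rw [← Finset.sum_product_right' S T fun s t => χ (s * t)]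
    simp only [charSum, mulMultiset, Multiset.map_map]
    rfl
  have hT : charSum χ T.val = ∑ t ∈ T, χ t := rfl
  rw [h, hT, Finset.mul_sum, Finset.mul_sum]
  refine Finset.sum_congr rfl fun t _ => ?_
  rw [← sum_indicator_mul, Irr.one_mul_sum hχ hS.isClassFunction_indicator,
    sum_indicator_mul_eq_charSum]

end Multisets

/-! ### The discriminant and the stabilizer through multiplicities -/

section Radicand

variable {G : Type*} [Group G] [Fintype G] [DecidableEq G] {T11 T22 T12 T21 : Finset G}

/-- The difference of the multiplicities in `I₂` and `I₃`. -/
def countDiff (T11 T22 T12 T21 : Finset G) (g : G) : ℤ :=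
  (I2 T11 T22 T12 T21).count g - (I3 T11 T22).count g

theorem charDiff_eq_sum (χ : G → ℂ) :
    charDiff T11 T22 T12 T21 χ = ∑ g, (countDiff T11 T22 T12 T21 g : ℂ) * χ g := by
  rw [charDiff, charSum_eq_sum_count, charSum_eq_sum_count, ← Finset.sum_sub_distrib]
  refine Finset.sum_congr rfl fun g _ => ?_
  rw [← sub_mul, ← Int.cast_sub]
  congr 2
  rw [countDiff, Multiset.count_sub, Multiset.count_sub]
  omega

theorem charDiff_eq_sub (χ : G → ℂ) :
    charDiff T11 T22 T12 T21 χ = charSum χ (I2 T11 T22 T12 T21) - charSum χ (I3 T11 T22) := by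
  rw [charDiff_eq_sum, charSum_eq_sum_count, charSum_eq_sum_count, ← Finset.sum_sub_distrib]
  exact Finset.sum_congr rfl fun g _ => by rw [countDiff, Int.cast_sub, sub_mul]

/-- The radicand is the discriminant of the characteristic polynomial of the `2 × 2` matrix
`(χ(Tᵢⱼ))`. -/
theorem radicand_eq (hT : IsQuasiAbelian T11 T22 T12 T21) {χ : G → ℂ} (hχ : χ ∈ Irr G) :
    radicand T11 T22 T12 T21 χ = (charSum χ T11.val - charSum χ T22.val) ^ 2 +
      4 * (charSum χ T12.val * charSum χ T21.val) := by
  obtain ⟨h11, h22, h12, h21⟩ := hT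
  rw [radicand, charDiff_eq_sub, I2, I3]
  simp only [charSum_add, charSum_nsmul]
  have e1 := Irr.one_mul_charSum_mulMultiset hχ h11 T11
  have e2 := Irr.one_mul_charSum_mulMultiset hχ h22 T22
  have e3 := Irr.one_mul_charSum_mulMultiset hχ h12 T21
  have e4 := Irr.one_mul_charSum_mulMultiset hχ h11 T22
  push_cast
  linear_combination e1 + e2 + 4 * e3 - 2 * e4

omit [Fintype G] in
theorem isClassFunction_countDiff (hT : IsQuasiAbelian T11 T22 T12 T21) :
    IsClassFunction (countDiff T11 T22 T12 T21) := by
  obtain ⟨h11, h22, h12, h21⟩ := hT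
  have h11 := h11.isClassMultiset
  have h22 := h22.isClassMultiset
  have h12 := h12.isClassMultiset
  have h21 := h21.isClassMultiset
  have h2 : IsClassMultiset (I2 T11 T22 T12 T21) :=
    ((h11.mulMultiset h11).add (h22.mulMultiset h22)).add ((h12.mulMultiset h21).nsmul 4)
  have h3 : IsClassMultiset (I3 T11 T22) := (h11.mulMultiset h22).nsmul 2
  intro x g
  have e2 := h2.count x g
  have e3 := h3.count x g
  simp only at e2 e3
  rw [countDiff, e2, e3, countDiff]

/-- The two truncated differences are the positive and negative parts of `countDiff`, so they are
both invariant exactly when it is. -/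
theorem mem_stabilizer_iff (t : (ZMod (Monoid.exponent G))ˣ) :
    t ∈ stabilizer T11 T22 T12 T21 ↔
      (∀ g, ((I1 T11 T22).count (powEquiv t g) : ℤ) = (I1 T11 T22).count g) ∧
        ∀ g, countDiff T11 T22 T12 T21 (powEquiv t g) = countDiff T11 T22 T12 T21 g := by
  have h : ∀ A : Multiset G, powMultiset A t = A ↔ ∀ g, A.count (powEquiv t g) = A.count g :=
    map_equiv_eq_self_iff (powEquiv t)
  change _ ∧ _ ∧ _ ↔ _
  rw [h, h, h, ← forall_and]
  simp only [countDiff, Multiset.count_sub, Nat.cast_inj]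
  refine and_congr_right fun _ => forall_congr' fun g => ?_
  omega

end Radicand

/-! ### Eigenvalues of the semi-Cayley digraph -/

section Spectrum

variable {G : Type*} [Group G] [Fintype G] [DecidableEq G] {T11 T22 T12 T21 : Finset G}

theorem sum_indicator_mul_inv (S : Finset G) (h : G) (f : G → ℂ) :
    ∑ g, indicator S (g * h⁻¹) * f g = ∑ x, indicator S x * f (x * h) := by
  rw [← Equiv.sum_comp (Equiv.mulRight h)]
  simp

theorem adjacencyMatrix_mulVec_inl (f : G ⊕ G → ℂ) (h : G) :
    (adjacencyMatrix (graph T11 T22 T12 T21)).mulVec f (Sum.inl h) =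
      ∑ x, indicator T11 x * f (Sum.inl (x * h)) +
        ∑ x, indicator T12 x * f (Sum.inr (x * h)) := by
  rw [← sum_indicator_mul_inv T11 h fun g => f (Sum.inl g),
    ← sum_indicator_mul_inv T12 h fun g => f (Sum.inr g), Matrix.mulVec, dotProduct,
    Fintype.sum_sum_type]
  classical
  exact congrArg₂ (· + ·)
    (Finset.sum_congr rfl fun g _ => congrArg (· * f _) (if_congr Iff.rfl rfl rfl))
    (Finset.sum_congr rfl fun g _ => congrArg (· * f _) (if_congr Iff.rfl rfl rfl))

theorem adjacencyMatrix_mulVec_inr (f : G ⊕ G → ℂ) (h : G) :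
    (adjacencyMatrix (graph T11 T22 T12 T21)).mulVec f (Sum.inr h) =
      ∑ x, indicator T21 x * f (Sum.inl (x * h)) +
        ∑ x, indicator T22 x * f (Sum.inr (x * h)) := by
  rw [← sum_indicator_mul_inv T21 h fun g => f (Sum.inl g),
    ← sum_indicator_mul_inv T22 h fun g => f (Sum.inr g), Matrix.mulVec, dotProduct,
    Fintype.sum_sum_type]
  classical
  exact congrArg₂ (· + ·)
    (Finset.sum_congr rfl fun g _ => congrArg (· * f _) (if_congr Iff.rfl rfl rfl))
    (Finset.sum_congr rfl fun g _ => congrArg (· * f _) (if_congr Iff.rfl rfl rfl))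

/-- The action of `G` by right translations on functions on two copies of `G`. -/
def rightTranslation (G : Type*) [Group G] : Representation ℂ G (G ⊕ G → ℂ) where
  toFun x := LinearMap.funLeft ℂ ℂ (Sum.map (· * x) (· * x))
  map_one' := by
    refine LinearMap.ext fun f => funext fun v => ?_
    rcases v with g | g <;> simp [LinearMap.funLeft]
  map_mul' x y := by
    refine LinearMap.ext fun f => funext fun v => ?_
    rcases v with g | g <;> simp [LinearMap.funLeft, mul_assoc]

omit [Fintype G] [DecidableEq G] in
@[simp]
theorem rightTranslation_inl (x g : G) (f : G ⊕ G → ℂ) :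
    rightTranslation G x f (Sum.inl g) = f (Sum.inl (g * x)) := rfl

omit [Fintype G] [DecidableEq G] in
@[simp]
theorem rightTranslation_inr (x g : G) (f : G ⊕ G → ℂ) :
    rightTranslation G x f (Sum.inr g) = f (Sum.inr (g * x)) := rfl

-- The adjacency operator translates on the left, the representation on the right; class functions
-- do not see the difference.
omit [DecidableEq G] in
theorem sum_mul_comm {a : G → ℂ} (ha : IsClassFunction a) (f : G → ℂ) (h : G) :
    ∑ x, a x * f (x * h) = ∑ x, a x * f (h * x) := by
  refine Fintype.sum_equiv (MulAut.conj h⁻¹).toEquiv _ _ fun x => ?_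
  simp only [MulEquiv.toEquiv_eq_coe, EquivLike.coe_coe, MulAut.conj_apply]
  rw [ha]
  congr 2; group

omit [DecidableEq G] in
theorem groupSum_rightTranslation_inl {a : G → ℂ} (ha : IsClassFunction a) (f : G ⊕ G → ℂ)
    (h : G) : groupSum (rightTranslation G) a f (Sum.inl h) = ∑ x, a x * f (Sum.inl (x * h)) := by
  rw [sum_mul_comm ha fun g => f (Sum.inl g)]
  simp [groupSum, LinearMap.sum_apply]

omit [DecidableEq G] in
theorem groupSum_rightTranslation_inr {a : G → ℂ} (ha : IsClassFunction a) (f : G ⊕ G → ℂ)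
    (h : G) : groupSum (rightTranslation G) a f (Sum.inr h) = ∑ x, a x * f (Sum.inr (x * h)) := by
  rw [sum_mul_comm ha fun g => f (Sum.inr g)]
  simp [groupSum, LinearMap.sum_apply]

theorem isRoot_charpoly_iff_exists_mulVec {n : Type*} [Fintype n] [DecidableEq n]
    (A : Matrix n n ℂ) (z : ℂ) :
    A.charpoly.IsRoot z ↔ ∃ f, f ≠ 0 ∧ A.mulVec f = z • f := by
  rw [Polynomial.IsRoot.def, Matrix.eval_charpoly, ← Matrix.exists_mulVec_eq_zero_iff]
  refine exists_congr fun f => and_congr_right fun _ => ?_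
  rw [Matrix.sub_mulVec, sub_eq_zero, eq_comm]
  simp [Matrix.scalar_apply, ← Matrix.smul_one_eq_diagonal, Matrix.smul_mulVec]

theorem exists_eigenvector_fin_two_iff (a b c d : ℂ) :
    (∃ x y : ℂ, (x ≠ 0 ∨ y ≠ 0) ∧ a * x + b * y = 0 ∧ c * x + d * y = 0) ↔ a * d = b * c := by
  rw [← sub_eq_zero, ← Matrix.det_fin_two_of, ← Matrix.exists_mulVec_eq_zero_iff]
  constructor
  · rintro ⟨x, y, h, h1, h2⟩
    refine ⟨![x, y], fun h0 => ?_, ?_⟩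
    · have hx := congrFun h0 0
      have hy := congrFun h0 1
      simp only [Matrix.cons_val_zero, Matrix.cons_val_one, Pi.zero_apply] at hx hy
      simp [hx, hy] at h
    · funext i
      fin_cases i <;> simpa [Matrix.mulVec, dotProduct, Fin.sum_univ_two]
  · rintro ⟨v, hv, h⟩
    refine ⟨v 0, v 1, ?_, ?_, ?_⟩
    · by_contra! hc
      exact hv (funext fun i => by fin_cases i <;> simp [hc])
    · simpa [Matrix.mulVec, dotProduct, Fin.sum_univ_two] using congrFun h 0
    · simpa [Matrix.mulVec, dotProduct, Fin.sum_univ_two] using congrFun h 1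

theorem isRoot_iff (hT : IsQuasiAbelian T11 T22 T12 T21) (z : ℂ) :
    (adjacencyMatrix (graph T11 T22 T12 T21)).charpoly.IsRoot z ↔ ∃ χ ∈ Irr G,
      (2 * (χ 1 * z) - charSum χ (I1 T11 T22)) ^ 2 = radicand T11 T22 T12 T21 χ := by
  have hdet : ∀ χ ∈ Irr G, (2 * (χ 1 * z) - charSum χ (I1 T11 T22)) ^ 2 =
        radicand T11 T22 T12 T21 χ ↔ (charSum χ T11.val - χ 1 * z) *
        (charSum χ T22.val - χ 1 * z) = charSum χ T12.val * charSum χ T21.val := by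
    intro χ hχ
    rw [radicand_eq hT hχ, I1, charSum_add]
    constructor <;> intro h
    · linear_combination h / 4
    · linear_combination 4 * h
  rw [isRoot_charpoly_iff_exists_mulVec]
  obtain ⟨h11, h22, h12, h21⟩ := hT
  have h11 := h11.isClassFunction_indicator
  have h22 := h22.isClassFunction_indicator
  have h12 := h12.isClassFunction_indicator
  have h21 := h21.isClassFunction_indicator
  set A := adjacencyMatrix (graph T11 T22 T12 T21)
  constructor
  · rintro ⟨f₀, hf₀, hAf₀⟩
    have hA : ∀ x f, A.mulVec (rightTranslation G x f) = rightTranslation G x (A.mulVec f) := by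
      intro x f
      funext v
      rcases v with g | g
      · simp only [A, adjacencyMatrix_mulVec_inl, rightTranslation_inl, rightTranslation_inr,
          mul_assoc]
      · simp only [A, adjacencyMatrix_mulVec_inr, rightTranslation_inl, rightTranslation_inr,
          mul_assoc]
    -- The `z`-eigenspace is invariant, so it contains a nonzero vector on which class functions act
    -- through one χ. At a point `h` where it does not vanish on both copies, the eigenvalue
    -- equation is a singular 2 × 2 system.
    let E : Subrepresentation (rightTranslation G) :=
      { toSubmodule := LinearMap.ker (A.mulVecLin - z • LinearMap.id)
        apply_mem_toSubmodule := fun x f hf => by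
          simp only [LinearMap.mem_ker, LinearMap.sub_apply, LinearMap.smul_apply,
            LinearMap.id_apply, Matrix.mulVecLin_apply, sub_eq_zero] at hf ⊢
          rw [hA, hf, map_smul] }
    have hmem : ∀ f, f ∈ E ↔ A.mulVec f = z • f := fun f => by
      change f ∈ LinearMap.ker _ ↔ _
      simp [sub_eq_zero]
    have hE : E ≠ ⊥ := fun h => by
      have := (hmem f₀).mpr hAf₀
      rw [h] at this
      exact hf₀ this
    obtain ⟨χ, hχ, f, hf, hf0, hact⟩ := exists_irr_of_ne_bot E hE
    have hd := Irr.one_ne_zero hχ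
    rw [hmem] at hf
    refine ⟨χ, hχ, (hdet χ hχ).mpr ((exists_eigenvector_fin_two_iff _ _ _ _).mp ?_)⟩
    have hl : ∀ a, IsClassFunction a → ∀ h, χ 1 * ∑ x, a x * f (Sum.inl (x * h)) =
        (∑ g, a g * χ g) * f (Sum.inl h) := fun a ha h => by
      rw [← groupSum_rightTranslation_inl ha, hact a ha, Pi.smul_apply, smul_eq_mul]
      field_simp
    have hr : ∀ a, IsClassFunction a → ∀ h, χ 1 * ∑ x, a x * f (Sum.inr (x * h)) =
        (∑ g, a g * χ g) * f (Sum.inr h) := fun a ha h => by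
      rw [← groupSum_rightTranslation_inr ha, hact a ha, Pi.smul_apply, smul_eq_mul]
      field_simp
    obtain ⟨h, hh⟩ : ∃ h, f (Sum.inl h) ≠ 0 ∨ f (Sum.inr h) ≠ 0 := by
      by_contra! hc
      exact hf0 (funext fun v => by rcases v with g | g <;> simp [hc])
    have e1 := congrFun hf (Sum.inl h)
    have e2 := congrFun hf (Sum.inr h)
    rw [adjacencyMatrix_mulVec_inl, Pi.smul_apply, smul_eq_mul] at e1
    rw [adjacencyMatrix_mulVec_inr, Pi.smul_apply, smul_eq_mul] at e2
    have l11 := hl _ h11 h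
    have l21 := hl _ h21 h
    have r12 := hr _ h12 h
    have r22 := hr _ h22 h
    rw [sum_indicator_mul_eq_charSum _ χ] at l11 l21 r12 r22
    refine ⟨f (Sum.inl h), f (Sum.inr h), hh, ?_, ?_⟩
    · linear_combination χ 1 * e1 - l11 - r12
    · linear_combination χ 1 * e2 - l21 - r22
  · rintro ⟨χ, hχ, h⟩
    have hd := Irr.one_ne_zero hχ
    rw [hdet χ hχ, ← exists_eigenvector_fin_two_iff] at h
    obtain ⟨x, y, hxy, e1, e2⟩ := h
    have key : ∀ a, IsClassFunction a → ∀ h c, χ 1 * ∑ g, a g * (c * χ (g * h)) =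
        c * (∑ g, a g * χ g) * χ h := fun a ha h c => by
      rw [mul_assoc c, ← Irr.one_mul_sum hχ ha, Finset.mul_sum, Finset.mul_sum, Finset.mul_sum]
      exact Finset.sum_congr rfl fun g _ => by ring
    -- Conversely, a kernel vector `(x, y)` of the 2 × 2 system, spread over the two copies by χ, is
    -- an eigenvector; it is nonzero because χ(1) ≠ 0.
    refine ⟨Sum.elim (fun g => x * χ g) (fun g => y * χ g), fun h0 => ?_, ?_⟩
    · rcases hxy with hx | hy
      · exact mul_ne_zero hx hd (congrFun h0 (Sum.inl 1))
      · exact mul_ne_zero hy hd (congrFun h0 (Sum.inr 1))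
    · funext v
      apply mul_left_cancel₀ hd
      rcases v with g | g
      · rw [adjacencyMatrix_mulVec_inl]
        simp only [Sum.elim_inl, Sum.elim_inr, Pi.smul_apply, smul_eq_mul]
        have k1 := key _ h11 g x
        have k2 := key _ h12 g y
        rw [sum_indicator_mul_eq_charSum _ χ] at k1 k2
        linear_combination k1 + k2 + χ g * e1
      · rw [adjacencyMatrix_mulVec_inr]
        simp only [Sum.elim_inl, Sum.elim_inr, Pi.smul_apply, smul_eq_mul]
        have k1 := key _ h21 g x
        have k2 := key _ h22 g y
        rw [sum_indicator_mul_eq_charSum _ χ] at k1 k2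
        linear_combination k1 + k2 + χ g * e2

end Spectrum

end SemiCayley

namespace SemiCayley

/-! ### Galois correspondence for a field given by generators -/

section FixedFields

variable {F Ω : Type*} [Field F] [Field Ω] [Algebra F Ω]

/-- The Galois correspondence for a subfield of a Galois extension that is given by generators. -/
theorem adjoin_eq_fixed_and_finrank (E : IntermediateField F Ω) {S : Set Ω} (hgal : IsGalois F E)
    (hfin : FiniteDimensional F E) (P : (E ≃ₐ[F] E) → Prop) (hS : ∀ x ∈ S, x ∈ E)
    (hP : ∀ σ, P σ ↔ ∀ x ∈ S, ∃ y : E, (y : Ω) = x ∧ σ y = y) :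
    (adjoin F S : Set Ω) = {x | ∃ y : E, (y : Ω) = x ∧ ∀ σ : E ≃ₐ[F] E, P σ → σ y = y} ∧
      Module.finrank F (adjoin F S) * Nat.card {σ // P σ} = Module.finrank F E := by
  have hle : adjoin F S ≤ E := adjoin_le_iff.mpr hS
  have hfix : ∀ σ, P σ ↔ σ ∈ (restrict hle).fixingSubgroup := by
    intro σ
    rw [hP]
    constructor
    · intro hσ
      -- If σ fixes the generators, all of `adjoin F S` lies in the fixed field of the cyclic group
      -- generated by σ.
      have key : adjoin F S ≤ lift (fixedField (Subgroup.zpowers σ)) := by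
        rw [adjoin_le_iff]
        intro x hx
        obtain ⟨y, rfl, hy⟩ := hσ x hx
        refine (mem_lift y).mpr ((mem_fixedField_iff _ _).mpr fun τ hτ => ?_)
        have : Subgroup.zpowers σ ≤ MulAction.stabilizer (E ≃ₐ[F] E) y := by
          rw [Subgroup.zpowers_le]
          exact hy
        exact this hτ
      rw [IntermediateField.mem_fixingSubgroup_iff]
      intro y hy
      exact (mem_fixedField_iff _ _).mp ((mem_lift y).mp (key ((mem_restrict hle y).mp hy))) σ
        (Subgroup.mem_zpowers σ)
    · intro hσ x hx
      rw [IntermediateField.mem_fixingSubgroup_iff] at hσ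
      exact ⟨⟨x, hS x hx⟩, rfl, hσ _ ((mem_restrict hle _).mpr (subset_adjoin F S hx))⟩
  have hmem : ∀ y : E, (y : Ω) ∈ adjoin F S ↔ ∀ σ : E ≃ₐ[F] E, P σ → σ y = y := fun y => by
    rw [← mem_restrict hle, ← IsGalois.fixedField_fixingSubgroup (restrict hle),
      mem_fixedField_iff]
    simp only [hfix]
  constructor
  · ext x
    constructor
    · exact fun hx => ⟨⟨x, hle hx⟩, rfl, (hmem _).mp hx⟩
    · rintro ⟨y, rfl, hy⟩
      exact (hmem y).mpr hy
  · rw [Nat.card_congr (Equiv.subtypeEquivRight hfix),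
      (restrictAlgEquiv hle).toLinearEquiv.finrank_eq,
      ← Module.finrank_mul_finrank F (restrict hle) E]
    exact congrArg _ (IsGalois.card_fixingSubgroup_eq_finrank (restrict hle))

end FixedFields

/-! ### The base field, the splitting field and the degree -/

section Fields

variable {G : Type*} [Group G] [Fintype G] [DecidableEq G] {T11 T22 T12 T21 : Finset G}

omit [Fintype G] [DecidableEq G] in
theorem Irr.one_mem {χ : G → ℂ} (hχ : χ ∈ Irr G) (K : IntermediateField ℚ ℂ) : χ 1 ∈ K := by
  obtain ⟨d, -, h⟩ := Irr.exists_natCast_eq_one hχ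
  rw [h]
  exact _root_.natCast_mem K d

omit [Fintype G] in
theorem radicand_mem_baseField {χ : G → ℂ} (hχ : χ ∈ Irr G) :
    radicand T11 T22 T12 T21 χ ∈ baseField T11 T22 T12 T21 :=
  mul_mem (Irr.one_mem hχ _) (subset_adjoin _ _ (Or.inr ⟨χ, hχ, rfl⟩))

theorem splittingField_eq_adjoin (hT : IsQuasiAbelian T11 T22 T12 T21) {r : (G → ℂ) → ℂ}
    (hr : ∀ χ ∈ Irr G, r χ ^ 2 = radicand T11 T22 T12 T21 χ) :
    splittingField (graph T11 T22 T12 T21) =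
      adjoin ℚ ((fun χ : G → ℂ => charSum χ (I1 T11 T22)) '' Irr G ∪ r '' Irr G) := by
  apply le_antisymm
  · rw [splittingField, adjoin_le_iff]
    intro z hz
    obtain ⟨χ, hχ, h⟩ := (isRoot_iff hT z).mp hz
    rw [← hr χ hχ] at h
    have hd := Irr.one_ne_zero hχ
    set L := adjoin ℚ ((fun χ : G → ℂ => charSum χ (I1 T11 T22)) '' Irr G ∪ r '' Irr G)
    have h1 : charSum χ (I1 T11 T22) ∈ L := subset_adjoin _ _ (Or.inl ⟨χ, hχ, rfl⟩)
    have h2 : r χ ∈ L := subset_adjoin _ _ (Or.inr ⟨χ, hχ, rfl⟩)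
    have h3 : 2 * χ 1 ∈ L := mul_mem (ofNat_mem L 2) (Irr.one_mem hχ L)
    rcases sq_eq_sq_iff_eq_or_eq_neg.mp h with h | h
    · have : z = (charSum χ (I1 T11 T22) + r χ) / (2 * χ 1) := by
        field_simp
        linear_combination h
      rw [this]
      exact div_mem (add_mem h1 h2) h3
    · have : z = (charSum χ (I1 T11 T22) - r χ) / (2 * χ 1) := by
        field_simp
        linear_combination h
      rw [this]
      exact div_mem (sub_mem h1 h2) h3
  · rw [adjoin_le_iff]
    have key : ∀ χ ∈ Irr G, charSum χ (I1 T11 T22) ∈ splittingField (graph T11 T22 T12 T21) ∧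
        r χ ∈ splittingField (graph T11 T22 T12 T21) := by
      intro χ hχ
      have hd := Irr.one_ne_zero hχ
      have hp : (charSum χ (I1 T11 T22) + r χ) / (2 * χ 1) ∈
          splittingField (graph T11 T22 T12 T21) := by
        refine subset_adjoin _ _ ((isRoot_iff hT _).mpr ⟨χ, hχ, ?_⟩)
        rw [← hr χ hχ]
        field_simp
        ring
      have hm : (charSum χ (I1 T11 T22) - r χ) / (2 * χ 1) ∈
          splittingField (graph T11 T22 T12 T21) := by
        refine subset_adjoin _ _ ((isRoot_iff hT _).mpr ⟨χ, hχ, ?_⟩)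
        rw [← hr χ hχ]
        field_simp
        ring
      have h1 := Irr.one_mem hχ (splittingField (graph T11 T22 T12 T21))
      constructor
      · convert mul_mem h1 (add_mem hp hm) using 1
        field_simp
        ring
      · convert mul_mem h1 (sub_mem hp hm) using 1
        field_simp
        ring
    rintro _ (⟨χ, hχ, rfl⟩ | ⟨χ, hχ, rfl⟩)
    · exact (key χ hχ).1
    · exact (key χ hχ).2

theorem splittingField_eq_restrictScalars (hT : IsQuasiAbelian T11 T22 T12 T21)
    {r : (G → ℂ) → ℂ} (hr : ∀ χ ∈ Irr G, r χ ^ 2 = radicand T11 T22 T12 T21 χ) :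
    splittingField (graph T11 T22 T12 T21) =
      (adjoin (baseField T11 T22 T12 T21) (r '' Irr G)).restrictScalars ℚ := by
  refine (splittingField_eq_adjoin hT hr).trans (Eq.trans ?_ (adjoin_adjoin_left ℚ _ _).symm)
  apply le_antisymm
  · exact adjoin.mono _ _ _ (Set.union_subset_union_left _ Set.subset_union_left)
  · rw [adjoin_le_iff]
    rintro _ ((⟨χ, hχ, rfl⟩ | ⟨χ, hχ, rfl⟩) | ⟨χ, hχ, rfl⟩)
    · exact subset_adjoin _ _ (Or.inl ⟨χ, hχ, rfl⟩)
    -- The generators `charDiff` of K are redundant once the roots are present: each is `r χ ^ 2 / χ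
    -- 1`.
    · have hd := Irr.one_ne_zero hχ
      have : charDiff T11 T22 T12 T21 χ = r χ ^ 2 / χ 1 := by
        rw [hr χ hχ, radicand]
        field_simp
      set L := adjoin ℚ ((fun χ : G → ℂ => charSum χ (I1 T11 T22)) '' Irr G ∪ r '' Irr G)
      have hL : r χ ∈ L := subset_adjoin _ _ (Or.inr ⟨χ, hχ, rfl⟩)
      rw [this]
      exact div_mem (_root_.pow_mem hL 2) (Irr.one_mem hχ L)
    · exact subset_adjoin _ _ (Or.inr ⟨χ, hχ, rfl⟩)

variable {ω : ℂ} (hω : IsPrimitiveRoot ω (Monoid.exponent G))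

theorem eta_mem_stabilizer_iff (hT : IsQuasiAbelian T11 T22 T12 T21)
    (σ : ℚ⟮ω⟯ ≃ₐ[ℚ] ℚ⟮ω⟯) :
    eta hω σ ∈ stabilizer T11 T22 T12 T21 ↔
      ∀ x ∈ (fun χ : G → ℂ => charSum χ (I1 T11 T22)) '' Irr G ∪
        charDiff T11 T22 T12 T21 '' Irr G, ∃ y : ℚ⟮ω⟯, (y : ℂ) = x ∧ σ y = y := by
  have h11 : ConjClosed T11 := hT.1
  have h22 : ConjClosed T22 := hT.2.1
  have h1 : IsClassFunction fun g => ((I1 T11 T22).count g : ℤ) := fun x g =>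
    congrArg Nat.cast ((h11.isClassMultiset.add h22.isClassMultiset).count x g)
  rw [mem_stabilizer_iff, ← fixes_charSums_iff hω h1,
    ← fixes_charSums_iff hω (isClassFunction_countDiff hT)]
  simp only [Set.mem_union, or_imp, forall_and, Set.forall_mem_image, charSum_eq_sum_count,
    charDiff_eq_sum]

theorem baseField_eq_and_finrank (hT : IsQuasiAbelian T11 T22 T12 T21) :
    (baseField T11 T22 T12 T21 : Set ℂ) =
        {x : ℂ | ∃ y : ℚ⟮ω⟯, (y : ℂ) = x ∧
          ∀ σ : ℚ⟮ω⟯ ≃ₐ[ℚ] ℚ⟮ω⟯, eta hω σ ∈ stabilizer T11 T22 T12 T21 → σ y = y} ∧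
      Module.finrank ℚ (baseField T11 T22 T12 T21) * Nat.card (stabilizer T11 T22 T12 T21) =
        Nat.totient (Monoid.exponent G) := by
  have := isCyclotomicExtension_adjoin hω
  have hgal := IsCyclotomicExtension.isGalois {Monoid.exponent G} ℚ ℚ⟮ω⟯
  have hfin := IsCyclotomicExtension.finiteDimensional {Monoid.exponent G} ℚ ℚ⟮ω⟯
  have hcard := Nat.card_congr ((Equiv.ofBijective _ (eta_bijective hω)).subtypeEquiv
    (p := fun σ => eta hω σ ∈ stabilizer T11 T22 T12 T21)
    (q := fun t => t ∈ stabilizer T11 T22 T12 T21) fun σ => Iff.rfl)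
  have h := adjoin_eq_fixed_and_finrank ℚ⟮ω⟯ hgal hfin
    (fun σ => eta hω σ ∈ stabilizer T11 T22 T12 T21) (by
      rintro _ (⟨χ, hχ, rfl⟩ | ⟨χ, hχ, rfl⟩)
      · obtain ⟨y, hy, -⟩ := exists_galois_sum hω (fun g => ((I1 T11 T22).count g : ℤ)) hχ
        beta_reduce
        rw [charSum_eq_sum_count, ← hy]
        exact y.2
      · obtain ⟨y, hy, -⟩ := exists_galois_sum hω (countDiff T11 T22 T12 T21) hχ
        rw [charDiff_eq_sum, ← hy]
        exact y.2) (eta_mem_stabilizer_iff hω hT)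
  refine ⟨h.1, ?_⟩
  rw [← IsCyclotomicExtension.Rat.finrank (Monoid.exponent G) ℚ⟮ω⟯]
  exact (congrArg _ hcard.symm).trans h.2

theorem finrank_splittingField (hT : IsQuasiAbelian T11 T22 T12 T21) {r : (G → ℂ) → ℂ}
    (hr : ∀ χ ∈ Irr G, r χ ^ 2 = radicand T11 T22 T12 T21 χ) :
    algebraicDegree (graph T11 T22 T12 T21) =
      Module.finrank ℚ (baseField T11 T22 T12 T21) *
        Nat.card (squareClassGroup (baseField T11 T22 T12 T21)
          (radicand T11 T22 T12 T21 '' Irr G)) := by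
  have hR : radicand T11 T22 T12 T21 '' Irr G = (fun x => x ^ 2) '' (r '' Irr G) := by
    rw [Set.image_image]
    exact Set.image_congr fun χ hχ => (hr χ hχ).symm
  rw [algebraicDegree, splittingField_eq_restrictScalars hT hr, hR,
    ← finrank_adjoin_eq_card_squareClassGroup]
  · exact (Module.finrank_mul_finrank ℚ (baseField T11 T22 T12 T21)
      (adjoin (baseField T11 T22 T12 T21) (r '' Irr G))).symm
  · rintro _ ⟨χ, hχ, rfl⟩
    rw [hr χ hχ]
    exact radicand_mem_baseField hχ

end Fields

end SemiCayley

open SemiCayley IntermediateField in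
theorem mainTheorem1 {G : Type*} [Group G] [Fintype G] [DecidableEq G]
    (T11 T22 T12 T21 : Finset G) (hT : IsQuasiAbelian T11 T22 T12 T21)
    (ω : ℂ) (hω : IsPrimitiveRoot ω (Monoid.exponent G))
    (r : (G → ℂ) → ℂ) (hr : ∀ χ ∈ Irr G, r χ ^ 2 = radicand T11 T22 T12 T21 χ) :
    splittingField (graph T11 T22 T12 T21) =
        adjoin ℚ ((fun χ : G → ℂ => charSum χ (I1 T11 T22)) '' Irr G ∪ r '' Irr G) ∧
      splittingField (graph T11 T22 T12 T21) =
        (adjoin (baseField T11 T22 T12 T21) (r '' Irr G)).restrictScalars ℚ ∧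
      (baseField T11 T22 T12 T21 : Set ℂ) =
        {x : ℂ | ∃ y : ℚ⟮ω⟯, (y : ℂ) = x ∧
          ∀ σ : ℚ⟮ω⟯ ≃ₐ[ℚ] ℚ⟮ω⟯, eta hω σ ∈ stabilizer T11 T22 T12 T21 → σ y = y} ∧
      (∀ χ ∈ Irr G, radicand T11 T22 T12 T21 χ ∈ baseField T11 T22 T12 T21) ∧
      (algebraicDegree (graph T11 T22 T12 T21) : ℚ) =
        (Nat.totient (Monoid.exponent G) : ℚ) *
          Nat.card (squareClassGroup (baseField T11 T22 T12 T21)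
            (radicand T11 T22 T12 T21 '' Irr G)) /
          Nat.card (stabilizer T11 T22 T12 T21) := by
  obtain ⟨hbase, hcard⟩ := baseField_eq_and_finrank hω hT
  refine ⟨splittingField_eq_adjoin hT hr, splittingField_eq_restrictScalars hT hr,
    hbase, fun χ hχ => radicand_mem_baseField hχ, ?_⟩
  -- The product formula `hcard` has the positive value φ(m), so neither factor vanishes.
  have hne : (Nat.card (stabilizer T11 T22 T12 T21) : ℚ) ≠ 0 := by
    intro h0
    rw [Nat.cast_eq_zero.mp h0, mul_zero] at hcard
    exact (Nat.totient_pos.mpr (NeZero.pos (Monoid.exponent G))).ne hcard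
  rw [finrank_splittingField hT hr, ← hcard]
  push_cast
  field_simp
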